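/- Let $d\in\{1,2,\dots\}$ and $S=\mathbb{R}^d\setminus\{0\}$, and let $\mathcal{M}(S)$ be the space of locally finite non-negative Borel measures on $S$ with the vague topology, i.e. the coarsest topology for which $m\mapsto\int_S f\,dm$ is continuous for every non-negative continuous function $f$ on $S$ with compact support. A random measure is a random element of $\mathcal{M}(S)$ with its Borel $\sigma$-algebra; it has finite intensity if $\mathbb{E}[\xi(A)]<\infty$ for every Borel set $A$ that is relatively compact in $S$. Write $\xrightarrow{vd}$ for convergence in distribution of random elements of $\mathcal{M}(S)$. For $t>0$ and $m\in\mathcal{M}(S)$ put $T_t m(A)=m(t^{-1}A)$ for Borel $A\subseteq S$. **Lemma.** Let $(s_n)_{n\ge1}$ be a non-decreasing sequence of positive real numbers with $s_n\to\infty$ and $\lim_{n\to\infty}s_{n-1}/s_n=1$. Let $\nu$ and $\mu$ be random measures on $S$ with finite intensity (possibly defined on different probability spaces) such that $T_{s_n}\nu\xrightarrow{vd}\mu$ as $n\to\infty$. Then $T_t\nu\xrightarrow{vd}\mu$ as $t\to\infty$ through the positive real numbers, and $\mu$ is scale-invariant, i.e. $T_c\mu$ has the same distribution as $\mu$ for every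 $c>0$. -/

import Mathlib

open MeasureTheory ProbabilityTheory Filter Topology
open scoped NNReal ENNReal CompactlySupported

/-- The punctured Euclidean space `ℝᵈ \ {0}`, with its subspace topology and Borel sets. -/
abbrev PuncturedSpace (d : ℕ) : Type := {x : EuclideanSpace ℝ (Fin d) // x ≠ 0}

/-- The space of locally finite measures on `S`. It is a plain `def`, so that it does not inherit
the subtype σ-algebra of `Measure S`: it carries the vague topology and the Borel σ-algebra. -/
def LocFinMeasure (S : Type*) [TopologicalSpace S] [MeasurableSpace S] : Type _ :=
  {m : Measure S // IsLocallyFiniteMeasure m}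

namespace LocFinMeasure

variable {S : Type*} [TopologicalSpace S] [MeasurableSpace S]

/-- The underlying measure. -/
def toMeasure (m : LocFinMeasure S) : Measure S := m.1

instance (m : LocFinMeasure S) : IsLocallyFiniteMeasure m.toMeasure := m.2

/-- The vague topology: the coarsest topology for which `m ↦ ∫ f dm` is continuous for every
non-negative continuous function `f` with compact support. -/
noncomputable instance : TopologicalSpace (LocFinMeasure S) :=
  ⨅ f : C_c(S, ℝ≥0),
    TopologicalSpace.induced (fun m : LocFinMeasure S => ∫ x, (f x : ℝ) ∂m.toMeasure) inferInstance

noncomputable instance : MeasurableSpace (LocFinMeasure S) := borel _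

instance : BorelSpace (LocFinMeasure S) := ⟨rfl⟩

end LocFinMeasure

/-- A random measure: a random element of the space of locally finite measures. -/
def IsRandomMeasure {Ω S : Type*} [MeasurableSpace Ω] [TopologicalSpace S] [MeasurableSpace S]
    (ξ : Ω → LocFinMeasure S) : Prop :=
  Measurable ξ

/-- Finite intensity: `E (ξ A) < ∞` for every relatively compact Borel set `A`. -/
def HasFiniteIntensity {Ω S : Type*} [MeasurableSpace Ω] [TopologicalSpace S] [MeasurableSpace S]
    (ξ : Ω → LocFinMeasure S) (P : Measure Ω) : Prop :=
  ∀ A : Set S, MeasurableSet A → IsCompact (closure A) → ∫⁻ ω, (ξ ω).toMeasure A ∂P < ∞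

/-- The scaling `x ↦ t x` of the punctured space, for `t > 0`. -/
noncomputable def scalePoint {d : ℕ} (t : {t : ℝ // 0 < t}) :
    PuncturedSpace d ≃ₜ PuncturedSpace d where
  toFun x := ⟨(t : ℝ) • (x : EuclideanSpace ℝ (Fin d)), smul_ne_zero t.2.ne' x.2⟩
  invFun x := ⟨(t : ℝ)⁻¹ • (x : EuclideanSpace ℝ (Fin d)), smul_ne_zero (inv_ne_zero t.2.ne') x.2⟩
  left_inv x := Subtype.ext (inv_smul_smul₀ t.2.ne' _)
  right_inv x := Subtype.ext (smul_inv_smul₀ t.2.ne' _)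
  continuous_toFun := by fun_prop
  continuous_invFun := by fun_prop

/-- Intrinsic scaling `T_t m`, the image of `m` under `x ↦ t x`, so `T_t m (A) = m (t⁻¹ A)`. -/
noncomputable def intrinsicScale {d : ℕ} (t : {t : ℝ // 0 < t})
    (m : LocFinMeasure (PuncturedSpace d)) : LocFinMeasure (PuncturedSpace d) :=
  ⟨m.toMeasure.map (scalePoint t), by
    refine ⟨fun x => ?_⟩
    obtain ⟨s, hs, hfin⟩ := m.toMeasure.finiteAt_nhds ((scalePoint t).symm x)
    refine ⟨(scalePoint t).symm ⁻¹' s, (scalePoint t).symm.continuous.continuousAt hs, ?_⟩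
    rw [← (scalePoint t).toMeasurableEquiv_coe, MeasurableEquiv.map_apply]
    simpa [← Set.preimage_comp] using hfin⟩

/-- The defining formula `T_t m (A) = m (t⁻¹ A)`. -/
theorem intrinsicScale_apply {d : ℕ} (t : {t : ℝ // 0 < t})
    (m : LocFinMeasure (PuncturedSpace d)) (A : Set (PuncturedSpace d)) :
    (intrinsicScale t m).toMeasure A = m.toMeasure
      {x | ∃ a ∈ A, (x : EuclideanSpace ℝ (Fin d)) = (t : ℝ)⁻¹ • (a : EuclideanSpace ℝ (Fin d))} := by
  have h : (intrinsicScale t m).toMeasure A = m.toMeasure (scalePoint t ⁻¹' A) := by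
    change m.toMeasure.map (scalePoint t) A = _
    rw [← (scalePoint t).toMeasurableEquiv_coe, MeasurableEquiv.map_apply]
  rw [h]
  congr 1
  ext x
  constructor
  · intro hx
    exact ⟨scalePoint t x, hx, (inv_smul_smul₀ t.2.ne' _).symm⟩
  · rintro ⟨a, ha, hxa⟩
    have : scalePoint t x = a := Subtype.ext (by
      change (t : ℝ) • (x : EuclideanSpace ℝ (Fin d)) = _
      rw [hxa, smul_inv_smul₀ t.2.ne'])
    simpa [this] using ha

/-- A random measure on `ℝᵈ \ {0}` is scale-invariant if `T_c ξ` has the same distribution as `ξ`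
for every `c > 0`. -/
def IsScaleInvariant {Ω : Type*} [MeasurableSpace Ω] {d : ℕ}
    (ξ : Ω → LocFinMeasure (PuncturedSpace d)) (P : Measure Ω) : Prop :=
  ∀ c : {c : ℝ // 0 < c}, IdentDistrib (fun ω => intrinsicScale c (ξ ω)) ξ P P

/-! For `s n ≤ t < s (n + 1)`, write `T_t ν = T_{t / s n} (T_{s n} ν)`. The factor `t / s n` lies
between `1` and `s (n + 1) / s n`, so it tends to `1`. Scaling is jointly continuous in the factor
and the measure (`continuous_intrinsicScale`), so a Slutsky argument with deterministic parameters
(`continuous_comp_param`) gives the limit `T_1 μ = μ`.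

For invariance, `T_{c s_n} ν` tends to `μ` by the first part and to `T_c μ` by continuous mapping.
Limits in distribution are unique because the vague topology is pseudometrizable
(`pseudoMetrizableSpace`). -/

/-- A real function converges if it is approximated, up to an arbitrarily small multiple of a
convergent function, by convergent functions. -/
theorem tendsto_of_approx_mul {α : Type*} {l : Filter α} {F G : α → ℝ} {a b : ℝ}
    (hG : Tendsto G l (𝓝 b))
    (h : ∀ δ > 0, ∃ (H : α → ℝ) (c : ℝ), Tendsto H l (𝓝 c) ∧ |c - a| ≤ δ * b ∧
      ∀ᶠ x in l, |F x - H x| ≤ δ * G x) : Tendsto F l (𝓝 a) := by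
  rw [Metric.tendsto_nhds]
  intro ε hε
  have hb : 0 < |b| + 1 := by positivity
  -- With this `δ`, both `δ * G x` and `δ * b` cost at most `ε / 3`; the last third is `|H x - c|`.
  have hδ : 0 < ε / (3 * (|b| + 1)) := by positivity
  obtain ⟨H, c, hH, hc, hF⟩ := h _ hδ
  have hmul : ε / (3 * (|b| + 1)) * (|b| + 1) = ε / 3 := by field_simp
  have hGb : ∀ᶠ x in l, G x < |b| + 1 :=
    hG.eventually_lt_const (lt_of_le_of_lt (le_abs_self b) (lt_add_one _))
  filter_upwards [hF, hGb, Metric.tendsto_nhds.1 hH (ε / 3) (by positivity)] with x h1 h2 h3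
  rw [Real.dist_eq] at h3 ⊢
  have h4 := mul_le_mul_of_nonneg_left h2.le hδ.le
  have h5 := mul_le_mul_of_nonneg_left ((le_abs_self b).trans (lt_add_one _).le) hδ.le
  have h6 : |F x - a| ≤ |F x - H x| + |H x - c| + |c - a| := by
    have := abs_sub_le (F x) (H x) a
    have := abs_sub_le (H x) c a
    linarith
  linarith

/-! ### The vague topology: joint continuity of integrals and pseudometrizability. -/

namespace LocFinMeasure

theorem continuous_iff_integral {S X : Type*} [TopologicalSpace S] [MeasurableSpace S]
    [TopologicalSpace X] {Φ : X → LocFinMeasure S} :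
    Continuous Φ ↔ ∀ f : C_c(S, ℝ≥0), Continuous fun x => ∫ s, (f s : ℝ) ∂(Φ x).toMeasure := by
  rw [continuous_iInf_rng]
  exact forall_congr' fun f => continuous_induced_rng

theorem continuous_integral {S : Type*} [TopologicalSpace S] [MeasurableSpace S]
    (f : C_c(S, ℝ≥0)) :
    Continuous fun m : LocFinMeasure S => ∫ s, (f s : ℝ) ∂m.toMeasure :=
  continuous_iff_integral.1 continuous_id f

variable {S : Type*} [TopologicalSpace S] [MeasurableSpace S]

theorem integrable_of_hasCompactSupport [OpensMeasurableSpace S] (m : LocFinMeasure S)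
    {f : S → ℝ} (hf : Continuous f) (hc : HasCompactSupport f) : Integrable f m.toMeasure :=
  hf.integrable_of_hasCompactSupport hc

theorem integrable_coe [OpensMeasurableSpace S] (m : LocFinMeasure S) (f : C_c(S, ℝ≥0)) :
    Integrable (fun s => (f s : ℝ)) m.toMeasure :=
  m.integrable_of_hasCompactSupport (NNReal.continuous_coe.comp f.continuous)
    (f.hasCompactSupport.comp_left (g := fun r : ℝ≥0 => (r : ℝ)) rfl)

theorem abs_integral_sub_le (m : LocFinMeasure S) {f h g : S → ℝ} {δ : ℝ}
    (hf : Integrable f m.toMeasure) (hh : Integrable h m.toMeasure)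
    (hg : Integrable g m.toMeasure) (hle : ∀ s, |f s - h s| ≤ δ * g s) :
    |∫ s, f s ∂m.toMeasure - ∫ s, h s ∂m.toMeasure| ≤ δ * ∫ s, g s ∂m.toMeasure := by
  rw [← integral_sub hf hh, ← integral_const_mul]
  exact (abs_integral_le_integral_abs).trans
    (integral_mono (hf.sub hh).abs (hg.const_mul δ) hle)

end LocFinMeasure

/-- Such a `g` turns a uniform error `δ` on `K` into an integral error of at most `δ * ∫ g`, and `∫
g` is itself vaguely continuous. -/
theorem IsCompact.exists_compactlySupported_eq_one {S : Type*} [TopologicalSpace S]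
    [LocallyCompactSpace S] [RegularSpace S] {K : Set S} (hK : IsCompact K) :
    ∃ g : C_c(S, ℝ≥0), ∀ s ∈ K, g s = 1 := by
  obtain ⟨f, hf1, -, hfc, -⟩ :=
    exists_continuous_one_zero_of_isCompact hK isClosed_empty (Set.disjoint_empty K)
  refine ⟨⟨⟨fun s => (f s).toNNReal, by fun_prop⟩,
    hfc.comp_left (g := Real.toNNReal) Real.toNNReal_zero⟩, fun s hs => ?_⟩
  change (f s).toNNReal = 1
  simp [hf1 hs]

namespace LocFinMeasure

variable {S : Type*} [TopologicalSpace S] [MeasurableSpace S]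

/-- The integral of a continuous function depending on a parameter, with locally uniformly compact
support, is jointly continuous in the parameter and the measure. -/
theorem continuousAt_integral_param [LocallyCompactSpace S] [T2Space S]
    [OpensMeasurableSpace S] {X : Type*} [TopologicalSpace X] {φ : X → S → ℝ≥0}
    (hφ : Continuous (Function.uncurry φ)) {x₀ : X} {K : Set S} (hK : IsCompact K)
    (hsupp : ∀ᶠ x in 𝓝 x₀, ∀ s ∉ K, φ x s = 0) (m₀ : LocFinMeasure S) :
    ContinuousAt (fun p : X × LocFinMeasure S => ∫ s, (φ p.1 s : ℝ) ∂p.2.toMeasure) (x₀, m₀) := by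
  obtain ⟨g, hg⟩ := hK.exists_compactlySupported_eq_one
  have hcs : ∀ x, (∀ s ∉ K, φ x s = 0) → HasCompactSupport (φ x) := fun x hx =>
    HasCompactSupport.intro hK hx
  have hφx : ∀ x, Continuous (φ x) := fun x =>
    hφ.comp (continuous_const.prodMk continuous_id)
  let f₀ : C_c(S, ℝ≥0) := ⟨⟨φ x₀, hφx x₀⟩, hcs x₀ hsupp.self_of_nhds⟩
  refine tendsto_of_approx_mul (G := fun p : X × LocFinMeasure S => ∫ s, (g s : ℝ) ∂p.2.toMeasure)
    (b := ∫ s, (g s : ℝ) ∂m₀.toMeasure)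
    (((continuous_integral g).comp continuous_snd).tendsto (x₀, m₀)) fun δ hδ =>
    ⟨fun p => ∫ s, (f₀ s : ℝ) ∂p.2.toMeasure, ∫ s, (f₀ s : ℝ) ∂m₀.toMeasure,
      ((continuous_integral f₀).comp continuous_snd).tendsto (x₀, m₀), ?_, ?_⟩
  · have : 0 ≤ δ * ∫ s, (g s : ℝ) ∂m₀.toMeasure :=
      mul_nonneg hδ.le (integral_nonneg fun s => (g s).2)
    simpa [f₀] using this
  -- Compactness of `K` makes the pointwise closeness of `φ x` to `φ x₀` uniform on `K`.
  · have huniv : ∀ᶠ x in 𝓝 x₀, ∀ s ∈ K, |(φ x s : ℝ) - φ x₀ s| < δ := by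
      refine hK.eventually_forall_of_forall_eventually fun s _ => ?_
      have hc : Continuous fun z : X × S => |(φ z.1 z.2 : ℝ) - φ x₀ z.2| :=
        ((NNReal.continuous_coe.comp hφ).sub
          (NNReal.continuous_coe.comp ((hφx x₀).comp continuous_snd))).abs
      exact hc.continuousAt.eventually_lt_const (by simpa using hδ)
    rw [nhds_prod_eq]
    filter_upwards [(hsupp.and huniv).prod_inl (𝓝 m₀)] with p ⟨hp0, hp1⟩
    let f : C_c(S, ℝ≥0) := ⟨⟨φ p.1, hφx p.1⟩, hcs p.1 hp0⟩
    refine p.2.abs_integral_sub_le (p.2.integrable_coe f) (p.2.integrable_coe f₀)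
      (p.2.integrable_coe g) fun s => ?_
    by_cases hs : s ∈ K
    · rw [hg s hs, NNReal.coe_one, mul_one]
      exact (hp1 s hs).le
    · have h2 : f₀ s = 0 := hsupp.self_of_nhds s hs
      rw [hp0 s hs, h2]
      simpa using mul_nonneg hδ.le (g s).2

/-- A countable family of compactly supported functions that approximates all of them. -/
theorem _root_.CompactlySupportedContinuousMap.exists_countable_approx (S : Type*)
    [TopologicalSpace S] [LocallyCompactSpace S] [T2Space S] [SecondCountableTopology S] :
    ∃ A : Set C_c(S, ℝ≥0), A.Countable ∧ ∀ f : C_c(S, ℝ≥0), ∃ g ∈ A, ∀ δ : ℝ, 0 < δ →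
      ∃ h ∈ A, ∀ s, |(f s : ℝ) - h s| ≤ δ * g s := by
  let K := CompactExhaustion.choice S
  choose g hg using fun n => (K.isCompact n).exists_compactlySupported_eq_one
  let E : ℕ → Set C(S, ℝ≥0) := fun n => {f | ∀ s ∉ K n, f s = 0}
  let toCc : ∀ n, E n → C_c(S, ℝ≥0) := fun n f =>
    ⟨f.1, HasCompactSupport.intro (K.isCompact n) f.2⟩
  -- The compact-open topology is second countable here, so each `E n` is separable; density within
  -- `E n` keeps the approximants supported in `K n`.
  choose D hDc hDd using fun n => TopologicalSpace.exists_countable_dense (E n)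
  refine ⟨Set.range g ∪ ⋃ n, toCc n '' D n,
    (Set.countable_range g).union (Set.countable_iUnion fun n => (hDc n).image _), fun f => ?_⟩
  obtain ⟨n, hn⟩ := K.exists_superset_of_isCompact f.hasCompactSupport
  refine ⟨g n, Or.inl ⟨n, rfl⟩, fun δ hδ => ?_⟩
  let f' : E n := ⟨f.toContinuousMap, fun s hs =>
    image_eq_zero_of_notMem_tsupport fun h => hs (hn h)⟩
  have hnear : ∀ᶠ h : E n in 𝓝 f', ∀ s ∈ K n, dist (f'.1 s) (h.1 s) < δ :=
    Metric.tendstoUniformlyOn_iff.1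
      (ContinuousMap.tendsto_iff_forall_isCompact_tendstoUniformlyOn.1
        (continuous_subtype_val.tendsto f') (K n) (K.isCompact n)) δ hδ
  obtain ⟨h, hhD, hh⟩ := ((hDd n).inter_nhds_nonempty hnear)
  refine ⟨toCc n h, Or.inr (Set.mem_iUnion.2 ⟨n, h, hhD, rfl⟩), fun s => ?_⟩
  by_cases hs : s ∈ K n
  · rw [hg n s hs, NNReal.coe_one, mul_one]
    exact (hh s hs).le
  · have h1 : f s = 0 := f'.2 s hs
    have h2 : toCc n h s = 0 := h.2 s hs
    rw [h1, h2]
    simpa using mul_nonneg hδ.le (g n s).2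

/-- The vague topology is pseudometrizable. -/
theorem pseudoMetrizableSpace [LocallyCompactSpace S] [T2Space S] [SecondCountableTopology S]
    [OpensMeasurableSpace S] : TopologicalSpace.PseudoMetrizableSpace (LocFinMeasure S) := by
  obtain ⟨A, hA, happ⟩ := CompactlySupportedContinuousMap.exists_countable_approx S
  have := hA.to_subtype
  let Φ : LocFinMeasure S → A → ℝ := fun m f => ∫ s, (f.1 s : ℝ) ∂m.toMeasure
  -- Countably many integrals already induce the topology, which is thus pulled back from a
  -- countable power of `ℝ`.
  have hΦ : IsInducing Φ := by
    rw [isInducing_iff_nhds]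
    refine fun m₀ => le_antisymm
      ((continuous_pi fun f : A => continuous_integral f.1).tendsto m₀).le_comap ?_
    have hA' : ∀ f ∈ A, Tendsto (fun m : LocFinMeasure S => ∫ s, (f s : ℝ) ∂m.toMeasure)
        (comap Φ (𝓝 (Φ m₀))) (𝓝 (∫ s, (f s : ℝ) ∂m₀.toMeasure)) := fun f hf =>
      ((continuous_apply (⟨f, hf⟩ : A)).tendsto (Φ m₀)).comp tendsto_comap
    refine le_of_le_of_eq (le_iInf fun f : C_c(S, ℝ≥0) => ?_) (nhds_iInf (a := m₀)
      (t := fun f : C_c(S, ℝ≥0) => TopologicalSpace.induced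
        (fun m : LocFinMeasure S => ∫ x, (f x : ℝ) ∂m.toMeasure) inferInstance)).symm
    rw [nhds_induced, ← tendsto_iff_comap]
    obtain ⟨g, hgA, hg⟩ := happ f
    refine tendsto_of_approx_mul (hA' g hgA) fun δ hδ => ?_
    obtain ⟨h, hhA, hh⟩ := hg δ hδ
    have hle : ∀ m : LocFinMeasure S,
        |∫ s, (f s : ℝ) ∂m.toMeasure - ∫ s, (h s : ℝ) ∂m.toMeasure| ≤
          δ * ∫ s, (g s : ℝ) ∂m.toMeasure := fun m =>
      m.abs_integral_sub_le (m.integrable_coe f) (m.integrable_coe h) (m.integrable_coe g) hh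
    refine ⟨_, _, hA' h hhA, ?_, .of_forall hle⟩
    rw [abs_sub_comm]
    exact hle m₀
  exact hΦ.pseudoMetrizableSpace

end LocFinMeasure

/-! ### Convergence in distribution with a convergent deterministic parameter. -/

namespace MeasureTheory

theorem TendstoInDistribution.tendsto_integral {ι E Ω' : Type*} {Ω : ι → Type*}
    {mΩ : ∀ i, MeasurableSpace (Ω i)} {P : ∀ i, Measure (Ω i)} [∀ i, IsProbabilityMeasure (P i)]
    {mΩ' : MeasurableSpace Ω'} {P' : Measure Ω'} [IsProbabilityMeasure P']
    [TopologicalSpace E] [MeasurableSpace E] [OpensMeasurableSpace E]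
    {X : ∀ i, Ω i → E} {Z : Ω' → E} {l : Filter ι} (h : TendstoInDistribution X l Z P P')
    (f : BoundedContinuousFunction E ℝ) :
    Tendsto (fun i => ∫ ω, f (X i ω) ∂(P i)) l (𝓝 (∫ ω, f (Z ω) ∂P')) := by
  have h1 := ProbabilityMeasure.tendsto_iff_forall_integral_tendsto.1 h.tendsto f
  have hf : ∀ ρ : Measure E, AEStronglyMeasurable f ρ := fun ρ =>
    f.continuous.measurable.aestronglyMeasurable
  simpa only [ProbabilityMeasure.coe_mk, integral_map h.aemeasurable_limit (hf _),
    integral_map (h.forall_aemeasurable _) (hf _)] using h1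

theorem tendstoInDistribution_of_integral {ι E Ω' : Type*} {Ω : ι → Type*}
    {mΩ : ∀ i, MeasurableSpace (Ω i)} {P : ∀ i, Measure (Ω i)} [∀ i, IsProbabilityMeasure (P i)]
    {mΩ' : MeasurableSpace Ω'} {P' : Measure Ω'} [IsProbabilityMeasure P']
    [TopologicalSpace E] [MeasurableSpace E] [OpensMeasurableSpace E]
    {X : ∀ i, Ω i → E} {Z : Ω' → E} {l : Filter ι}
    (hX : ∀ i, AEMeasurable (X i) (P i)) (hZ : AEMeasurable Z P')
    (h : ∀ f : BoundedContinuousFunction E ℝ,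
      Tendsto (fun i => ∫ ω, f (X i ω) ∂(P i)) l (𝓝 (∫ ω, f (Z ω) ∂P'))) :
    TendstoInDistribution X l Z P P' := by
  refine ⟨hX, hZ, ProbabilityMeasure.tendsto_iff_forall_integral_tendsto.2 fun f => ?_⟩
  have hf : ∀ ρ : Measure E, AEStronglyMeasurable f ρ := fun ρ =>
    f.continuous.measurable.aestronglyMeasurable
  simpa only [ProbabilityMeasure.coe_mk, integral_map hZ (hf _),
    integral_map (hX _) (hf _)] using h f

theorem TendstoInDistribution.comp_tendsto {ι κ E Ω' : Type*} {Ω : ι → Type*}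
    {mΩ : ∀ i, MeasurableSpace (Ω i)} {P : ∀ i, Measure (Ω i)} [∀ i, IsProbabilityMeasure (P i)]
    {mΩ' : MeasurableSpace Ω'} {P' : Measure Ω'} [IsProbabilityMeasure P']
    [TopologicalSpace E] [MeasurableSpace E] [OpensMeasurableSpace E]
    {X : ∀ i, Ω i → E} {Z : Ω' → E} {l : Filter ι} (h : TendstoInDistribution X l Z P P')
    {k : Filter κ} {n : κ → ι} (hn : Tendsto n k l) :
    TendstoInDistribution (fun j => X (n j)) k Z (fun j => P (n j)) P' :=
  ⟨fun j => h.forall_aemeasurable (n j), h.aemeasurable_limit, h.tendsto.comp hn⟩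

/-- If `X i` tends to `Z` in distribution and `c i` tends to `c₀`, then for jointly continuous `T`
and bounded continuous `f` the expectations of `f (T (c i) (X i))` are eventually almost bounded
below by that of `f (T c₀ Z)`. -/
theorem TendstoInDistribution.eventually_lt_integral_param {ι E Ω' C : Type*}
    {Ω : ι → Type*} {mΩ : ∀ i, MeasurableSpace (Ω i)} {P : ∀ i, Measure (Ω i)}
    [∀ i, IsProbabilityMeasure (P i)]
    {mΩ' : MeasurableSpace Ω'} {P' : Measure Ω'} [IsProbabilityMeasure P']
    [TopologicalSpace E] [MeasurableSpace E] [OpensMeasurableSpace E]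
    [TopologicalSpace C] [LocallyCompactSpace C] [FirstCountableTopology C]
    {X : ∀ i, Ω i → E} {Z : Ω' → E} {l : Filter ι} (h : TendstoInDistribution X l Z P P')
    {c : ι → C} {c₀ : C} (hc : Tendsto c l (𝓝 c₀)) {F : E → C → ℝ}
    (hF : Continuous (Function.uncurry F)) {B : ℝ} (hB : ∀ x t, |F x t| ≤ B)
    {ε : ℝ} (hε : 0 < ε) :
    ∀ᶠ i in l, ∫ ω, F (Z ω) c₀ ∂P' - ε < ∫ ω, F (X i ω) (c i) ∂(P i) := by
  obtain ⟨K, hK, hKb⟩ := (compact_basis_nhds c₀).exists_antitone_subbasis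
  have hmem : ∀ k, c₀ ∈ K k := fun k => mem_of_mem_nhds (hK k).1
  have hFx : ∀ x, Continuous (F x) := fun x =>
    hF.comp (continuous_const.prodMk continuous_id)
  have hFt : ∀ t, Continuous fun x => F x t := fun t =>
    hF.comp (continuous_id.prodMk continuous_const)
  have hbdd : ∀ k x, BddBelow (F x '' K k) := fun k x =>
    ⟨-B, by rintro _ ⟨t, -, rfl⟩; exact (abs_le.1 (hB x t)).1⟩
  have hinf_le : ∀ k x, ∀ t ∈ K k, sInf (F x '' K k) ≤ F x t := fun k x t ht =>
    csInf_le (hbdd k x) ⟨t, ht, rfl⟩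
  have hle_inf : ∀ k x r, (∀ t ∈ K k, r ≤ F x t) → r ≤ sInf (F x '' K k) := fun k x r hr =>
    le_csInf ⟨_, c₀, hmem k, rfl⟩ (by rintro _ ⟨t, ht, rfl⟩; exact hr t ht)
  -- An infimum over a compact parameter set stays continuous in `x`, so it is an admissible test
  -- function not involving `c i`, and a lower bound for `F x (c i)` once `c i ∈ K k`.
  have hG : ∀ k, Continuous fun x => sInf (F x '' K k) := fun k => (hK k).2.continuous_sInf hF
  have hGB : ∀ k x, |sInf (F x '' K k)| ≤ B := fun k x =>
    abs_le.2 ⟨hle_inf k x _ fun t _ => (abs_le.1 (hB x t)).1,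
      (hinf_le k x c₀ (hmem k)).trans (abs_le.1 (hB x c₀)).2⟩
  -- As `K k` shrinks to `c₀`, the infima tend to `F x c₀` pointwise, dominated by `B`.
  have hlim : Tendsto (fun k => ∫ ω, sInf (F (Z ω) '' K k) ∂P') atTop
      (𝓝 (∫ ω, F (Z ω) c₀ ∂P')) := by
    refine tendsto_integral_of_dominated_convergence (fun _ => B)
      (fun k => ((hG k).measurable.comp_aemeasurable h.aemeasurable_limit).aestronglyMeasurable)
      (integrable_const B) (fun k => .of_forall fun ω => hGB k _) (.of_forall fun ω => ?_)
    rw [Metric.tendsto_atTop]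
    intro η hη
    have hnear : {t | F (Z ω) c₀ - η / 2 < F (Z ω) t} ∈ 𝓝 c₀ :=
      (hFx (Z ω)).continuousAt.eventually_const_lt (by linarith)
    obtain ⟨N, -, hN⟩ := hKb.toHasBasis.mem_iff.1 hnear
    refine ⟨N, fun k hk => ?_⟩
    have h1 := hle_inf k (Z ω) (F (Z ω) c₀ - η / 2) fun t ht =>
      le_of_lt (hN (hKb.antitone hk ht))
    have h2 := hinf_le k (Z ω) c₀ (hmem k)
    rw [Real.dist_eq, abs_lt]
    constructor <;> linarith
  obtain ⟨k, hk⟩ := (hlim.eventually_const_lt (sub_lt_self _ (half_pos hε))).exists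
  let f : BoundedContinuousFunction E ℝ :=
    BoundedContinuousFunction.ofNormedAddCommGroup _ (hG k) B (hGB k)
  have hXf := (h.tendsto_integral f).eventually_const_lt (sub_lt_self _ (half_pos hε))
  filter_upwards [hXf, hc (hK k).1] with i hi hci
  have hmono : ∫ ω, f (X i ω) ∂(P i) ≤ ∫ ω, F (X i ω) (c i) ∂(P i) := by
    refine integral_mono ?_ ?_ fun ω => hinf_le k _ _ hci
    · exact Integrable.of_bound
        ((hG k).measurable.comp_aemeasurable (h.forall_aemeasurable i)).aestronglyMeasurable B
        (.of_forall fun ω => hGB k _)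
    · exact Integrable.of_bound
        ((hFt _).measurable.comp_aemeasurable (h.forall_aemeasurable i)).aestronglyMeasurable B
        (.of_forall fun ω => hB _ _)
  have hZf : ∫ ω, f (Z ω) ∂P' = ∫ ω, sInf (F (Z ω) '' K k) ∂P' := rfl
  linarith

/-- A version of Slutsky's theorem: if `X i` tends to `Z` in distribution and the deterministic
parameters `c i` tend to `c₀`, then `T (c i) (X i)` tends to `T c₀ Z` in distribution for every
jointly continuous `T`. -/
theorem TendstoInDistribution.continuous_comp_param {ι E E' Ω' C : Type*}
    {Ω : ι → Type*} {mΩ : ∀ i, MeasurableSpace (Ω i)} {P : ∀ i, Measure (Ω i)}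
    [∀ i, IsProbabilityMeasure (P i)]
    {mΩ' : MeasurableSpace Ω'} {P' : Measure Ω'} [IsProbabilityMeasure P']
    [TopologicalSpace E] [MeasurableSpace E] [OpensMeasurableSpace E]
    [TopologicalSpace E'] [MeasurableSpace E'] [BorelSpace E']
    [TopologicalSpace C] [LocallyCompactSpace C] [FirstCountableTopology C]
    {X : ∀ i, Ω i → E} {Z : Ω' → E} {l : Filter ι} (h : TendstoInDistribution X l Z P P')
    {c : ι → C} {c₀ : C} (hc : Tendsto c l (𝓝 c₀)) {T : C → E → E'}
    (hT : Continuous (Function.uncurry T)) :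
    TendstoInDistribution (fun i ω => T (c i) (X i ω)) l (fun ω => T c₀ (Z ω)) P P' := by
  have hTc : ∀ t, Measurable (T t) := fun t =>
    (hT.comp (continuous_const.prodMk continuous_id)).measurable
  refine tendstoInDistribution_of_integral
    (fun i => (hTc _).comp_aemeasurable (h.forall_aemeasurable i))
    ((hTc _).comp_aemeasurable h.aemeasurable_limit) fun f => ?_
  have hF : Continuous (Function.uncurry fun (x : E) (t : C) => f (T t x)) :=
    f.continuous.comp (hT.comp continuous_swap)
  have hB : ∀ x t, |f (T t x)| ≤ ‖f‖ := fun x t => f.norm_coe_le_norm _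
  rw [Metric.tendsto_nhds]
  intro ε hε
  have hlow := h.eventually_lt_integral_param hc hF hB hε
  -- The lower bound applied to `-F` is the upper bound for `F`.
  have hup := h.eventually_lt_integral_param hc (F := fun x t => -f (T t x)) hF.neg
    (fun x t => (abs_neg _).trans_le (hB x t)) hε
  filter_upwards [hlow, hup] with i h1 h2
  rw [integral_neg, integral_neg] at h2
  rw [Real.dist_eq, abs_lt]
  constructor <;> linarith

end MeasureTheory

/-! ### Scaling on the punctured space, and the main argument. -/

instance {d : ℕ} : LocallyCompactSpace (PuncturedSpace d) :=
  (isOpen_ne (x := (0 : EuclideanSpace ℝ (Fin d)))).locallyCompactSpace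

instance : LocallyCompactSpace {t : ℝ // 0 < t} :=
  (isOpen_lt continuous_const continuous_id).locallyCompactSpace

theorem integral_intrinsicScale {d : ℕ} (t : {t : ℝ // 0 < t})
    (m : LocFinMeasure (PuncturedSpace d)) (f : PuncturedSpace d → ℝ) :
    ∫ x, f x ∂(intrinsicScale t m).toMeasure = ∫ x, f (scalePoint t x) ∂m.toMeasure :=
  (scalePoint t).measurableEmbedding.integral_map f

theorem intrinsicScale_mul {d : ℕ} (a b : {t : ℝ // 0 < t})
    (m : LocFinMeasure (PuncturedSpace d)) :
    intrinsicScale (a * b) m = intrinsicScale a (intrinsicScale b m) := by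
  refine Subtype.ext ?_
  change m.toMeasure.map (scalePoint (a * b)) =
    (m.toMeasure.map (scalePoint b)).map (scalePoint a)
  rw [Measure.map_map (scalePoint a).continuous.measurable (scalePoint b).continuous.measurable]
  congr 1
  ext1 x
  exact Subtype.ext (mul_smul (a : ℝ) (b : ℝ) (x : EuclideanSpace ℝ (Fin d)))

theorem intrinsicScale_one {d : ℕ} (m : LocFinMeasure (PuncturedSpace d)) :
    intrinsicScale 1 m = m := by
  refine Subtype.ext ?_
  change m.toMeasure.map (scalePoint 1) = m.toMeasure
  have : ⇑(scalePoint (d := d) 1) = id :=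
    funext fun x => Subtype.ext (one_smul ℝ (x : EuclideanSpace ℝ (Fin d)))
  rw [this, Measure.map_id]

/-- Intrinsic scaling is jointly continuous in the factor and the measure. -/
theorem continuous_intrinsicScale {d : ℕ} :
    Continuous (Function.uncurry (intrinsicScale (d := d))) := by
  have hsm : Continuous fun p : {t : ℝ // 0 < t} × PuncturedSpace d => scalePoint p.1 p.2 :=
    Continuous.subtype_mk (by fun_prop) _
  have hsymm : Continuous fun p : {t : ℝ // 0 < t} × PuncturedSpace d =>
      (scalePoint p.1).symm p.2 :=
    Continuous.subtype_mk (((continuous_subtype_val.comp continuous_fst).inv₀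
      fun p => p.1.2.ne').smul (continuous_subtype_val.comp continuous_snd)) _
  refine LocFinMeasure.continuous_iff_integral.2 fun f => continuous_iff_continuousAt.2 ?_
  rintro ⟨t₀, m₀⟩
  simp only [Function.uncurry, integral_intrinsicScale]
  obtain ⟨N, hN, hN₀⟩ := exists_compact_mem_nhds t₀
  -- For `t ∈ N` the support of `x ↦ f (t x)` is contained in this one compact set, the image of `N
  -- × supp f` under `(t, x) ↦ t⁻¹ x`.
  have hK := (hN.prod f.hasCompactSupport.isCompact).image hsymm
  refine LocFinMeasure.continuousAt_integral_param
    (φ := fun t x => f (scalePoint t x)) (f.continuous.comp hsm) hK ?_ m₀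
  filter_upwards [hN₀] with t ht x hx
  refine image_eq_zero_of_notMem_tsupport fun h => hx ?_
  exact ⟨(t, scalePoint t x), ⟨ht, h⟩, (scalePoint t).symm_apply_apply x⟩

/-- Every large real number lies in an interval `[s n, s (n + 1))` with `n` large, if `s` increases
to infinity. -/
theorem exists_index_le_lt_succ {s : ℕ → ℝ} (hmono : Monotone s) (hs : Tendsto s atTop atTop) :
    ∃ n : ℝ → ℕ, Tendsto n atTop atTop ∧ ∀ t, s 0 ≤ t → s (n t) ≤ t ∧ t < s (n t + 1) := by
  have hex : ∀ t, ∃ k, t < s (k + 1) := fun t =>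
    (((tendsto_add_atTop_iff_nat 1).2 hs).eventually_gt_atTop t).exists
  classical
  refine ⟨fun t => Nat.find (hex t), tendsto_atTop.2 fun k => ?_, fun t ht =>
    ⟨?_, Nat.find_spec (hex t)⟩⟩
  · filter_upwards [eventually_ge_atTop (s k)] with t ht
    by_contra! hlt
    exact absurd (Nat.find_spec (hex t)) (not_lt.2 ((hmono hlt).trans ht))
  -- Minimality of the index gives `s (n t) ≤ t`, except at index `0`, where `s 0 ≤ t` is needed.
  · beta_reduce
    rcases hn : Nat.find (hex t) with _ | j
    · exact ht
    · exact not_lt.1 (Nat.find_min (hex t) (m := j) (by omega))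

theorem lemma2p1 (d : ℕ) (hd : 1 ≤ d)
    (s : ℕ → ℝ) (hs_pos : ∀ n, 0 < s n) (hs_mono : Monotone s)
    (hs_top : Tendsto s atTop atTop)
    (hs_ratio : Tendsto (fun n => s n / s (n + 1)) atTop (𝓝 1))
    {Ω Ω' : Type*} [MeasurableSpace Ω] [MeasurableSpace Ω']
    (P : Measure Ω) [IsProbabilityMeasure P] (P' : Measure Ω') [IsProbabilityMeasure P']
    (ν : Ω → LocFinMeasure (PuncturedSpace d)) (μ : Ω' → LocFinMeasure (PuncturedSpace d))
    (hν : IsRandomMeasure ν) (hμ : IsRandomMeasure μ)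
    (hν_fin : HasFiniteIntensity ν P) (hμ_fin : HasFiniteIntensity μ P')
    (hconv : TendstoInDistribution (fun (n : ℕ) ω => intrinsicScale ⟨s n, hs_pos n⟩ (ν ω))
      atTop μ (fun _ => P) P') :
    TendstoInDistribution (fun (t : {t : ℝ // 0 < t}) ω => intrinsicScale t (ν ω))
      atTop μ (fun _ => P) P' ∧
    IsScaleInvariant μ P' := by
  have htop : Tendsto (fun t : {t : ℝ // 0 < t} => (t : ℝ)) atTop atTop :=
    tendsto_atTop.2 fun a => (eventually_ge_atTop ⟨max a 1, by positivity⟩).mono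
      fun t ht => (le_max_left a 1).trans ht
  obtain ⟨n, hn_top, hn⟩ := exists_index_le_lt_succ hs_mono hs_top
  let σ : ℕ → {t : ℝ // 0 < t} := fun k => ⟨s k, hs_pos k⟩
  have hn' := hn_top.comp htop
  have hratio : Tendsto (fun t : {t : ℝ // 0 < t} => t / σ (n t)) atTop (𝓝 1) := by
    rw [tendsto_subtype_rng]
    have hinv : Tendsto (fun k => s (k + 1) / s k) atTop (𝓝 1) := by
      simpa using hs_ratio.inv₀ one_ne_zero
    refine tendsto_of_tendsto_of_tendsto_of_le_of_le' tendsto_const_nhds (hinv.comp hn') ?_ ?_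
    · filter_upwards [htop.eventually_ge_atTop (s 0)] with t ht
      exact (one_le_div (hs_pos _)).2 (hn t ht).1
    · filter_upwards [htop.eventually_ge_atTop (s 0)] with t ht
      exact div_le_div_of_nonneg_right (hn t ht).2.le (hs_pos _).le
  have hT : TendstoInDistribution (fun (t : {t : ℝ // 0 < t}) ω => intrinsicScale t (ν ω))
      atTop μ (fun _ => P) P' := by
    have h := (hconv.comp_tendsto hn').continuous_comp_param hratio continuous_intrinsicScale
    -- The factors recombine as `(t / s n) * s n = t`, and the limit `T_1 μ` is `μ`.
    simpa only [Function.comp_apply, ← intrinsicScale_mul, σ, div_mul_cancel, intrinsicScale_one]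
      using h
  refine ⟨hT, fun c => ?_⟩
  have hTc : Continuous (intrinsicScale (d := d) c) :=
    continuous_intrinsicScale.comp (continuous_const.prodMk continuous_id)
  refine ⟨hTc.measurable.comp_aemeasurable hμ.aemeasurable, hμ.aemeasurable, ?_⟩
  have hmul : Tendsto (fun k => c * σ k) atTop atTop :=
    tendsto_atTop.2 fun a => ((hs_top.const_mul_atTop c.2).eventually_ge_atTop (a : ℝ)).mono
      fun k hk => hk
  -- Two limits of the same sequence `T_{c s_k} ν`: `μ` along the subfamily `c * s k`, and `T_c μ`
  -- by continuity of `T_c`.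
  have h1 := hT.comp_tendsto hmul
  have h2 := hconv.continuous_comp hTc
  simp only [intrinsicScale_mul] at h1
  have := LocFinMeasure.pseudoMetrizableSpace (S := PuncturedSpace d)
  let := TopologicalSpace.pseudoMetrizableSpacePseudoMetric (LocFinMeasure (PuncturedSpace d))
  exact tendstoInDistribution_unique _ h2 h1
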